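/- Let $K\ge 1$ and let $\mathbf X_1,\mathbf X_2,\dots$ be i.i.d. $\mathbb R^K$-valued random vectors, $\mathbf X_i=(X_{i,1},\dots,X_{i,K})'$, such that for every $k\in\{1,\dots,K\}$ the cumulative distribution function $F_k$ of $X_{1,k}$ is continuous. Let $n_1=n_1(n)$ be integers, $1\le n_1<n$ for all large $n$, with $n_1/n\to t_1\in(0,1)$ as $n\to\infty$, and assume that the $K\times K$ matrix $\Sigma$ with entries $$\Sigma_{kk'}=4\,\mathrm{cov}\bigl(F_k(X_{1,k}),F_{k'}(X_{1,k'})\bigr),\qquad 1\le k,k'\le K,$$ is positive definite. Define $\mathbf U_n(n_1)=(U_{n,1}(n_1),\dots,U_{n,K}(n_1))'$ by $$U_{n,k}(n_1)=\frac{1}{\sqrt{n\,n_1(n-n_1)}}\sum_{i=1}^{n_1}\sum_{j=n_1+1}^{n}\bigl\{\mathbf 1(X_{i,k}\le X_{j,k})-\mathbf 1(X_{j,k}\le X_{i,k})\bigr\},$$ let $\hat F_{n,k}(t)=n^{-1}\sum_{j=1}^n\mathbf 1(X_{j,k}\le t)$, and let $\hat\Sigma_n$ be the $K\times K$ matrix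 with entries $$\hat\Sigma_{n,kk'}=\frac4n\sum_{i=1}^n\bigl\{\hat F_{n,k}(X_{i,k})-\tfrac12\bigr\}\bigl\{\hat F_{n,k'}(X_{i,k'})-\tfrac12\bigr\}.$$ Then the probability that $\hat\Sigma_n$ is invertible tends to $1$, and the statistic $$S_n(n_1)=\mathbf U_n(n_1)'\,\hat\Sigma_n^{-1}\,\mathbf U_n(n_1)$$ (set to $0$ on the event that $\hat\Sigma_n$ is singular) converges in distribution, as $n\to\infty$, to the $\chi^2$ distribution with $K$ degrees of freedom. -/

import Mathlib

open MeasureTheory ProbabilityTheory Filter Topology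

noncomputable section

namespace MultivariateWilcoxon

/-! The data are the rows `x 0, …, x (n - 1)` of a sequence of vectors in `ℝ^K`; thus the `i`-th
observation (counted from one) is `x (i - 1)`. The first sample is `x 0, …, x (n₁ - 1)` and the
second one is `x n₁, …, x (n - 1)`. -/

/-- The vector `U_n(n₁)` of two-sample Wilcoxon / Mann-Whitney statistics, one per coordinate. -/
def wilcoxonVector {K : ℕ} (n n₁ : ℕ) (x : ℕ → Fin K → ℝ) : Fin K → ℝ := fun k =>
  1 / √((n : ℝ) * (n₁ : ℝ) * ((n : ℝ) - (n₁ : ℝ))) *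
    ∑ i ∈ Finset.range n₁, ∑ j ∈ Finset.Ico n₁ n,
      ((if x i k ≤ x j k then (1 : ℝ) else 0) - (if x j k ≤ x i k then (1 : ℝ) else 0))

/-- The empirical c.d.f. of the `k`-th coordinate of the first `n` observations. -/
def empiricalCDF {K : ℕ} (n : ℕ) (x : ℕ → Fin K → ℝ) (k : Fin K) (t : ℝ) : ℝ :=
  (n : ℝ)⁻¹ * ∑ j ∈ Finset.range n, if x j k ≤ t then (1 : ℝ) else 0

/-- The rank-based empirical covariance matrix of the first `n` observations. -/
def empiricalCovMatrix {K : ℕ} (n : ℕ) (x : ℕ → Fin K → ℝ) : Matrix (Fin K) (Fin K) ℝ :=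
  Matrix.of fun k k' => 4 / (n : ℝ) * ∑ i ∈ Finset.range n,
    (empiricalCDF n x k (x i k) - 1 / 2) * (empiricalCDF n x k' (x i k') - 1 / 2)

/-- The test statistic `S_n(n₁) = U_n(n₁)' Σ̂_n⁻¹ U_n(n₁)`. If `Σ̂_n` is singular, the matrix
inverse is `0` by convention and the statistic is `0`. -/
def wilcoxonStatistic {K : ℕ} (n n₁ : ℕ) (x : ℕ → Fin K → ℝ) : ℝ :=
  wilcoxonVector n n₁ x ⬝ᵥ (Matrix.mulVec (empiricalCovMatrix n x)⁻¹ (wilcoxonVector n n₁ x))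

/-- The c.d.f. of the `k`-th coordinate of the random vector `Y`. -/
def marginalCDF {Ω : Type*} [MeasurableSpace Ω] {K : ℕ} (P : Measure Ω) (Y : Ω → Fin K → ℝ)
    (k : Fin K) : ℝ → ℝ :=
  fun t => cdf (P.map (fun ω => Y ω k)) t

/-- The matrix with entries `4 cov(F_k(Y_k), F_k'(Y_k'))`, where `F_k` is the c.d.f. of `Y_k`. -/
def rankCovMatrix {Ω : Type*} [MeasurableSpace Ω] {K : ℕ} (P : Measure Ω) (Y : Ω → Fin K → ℝ) :
    Matrix (Fin K) (Fin K) ℝ :=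
  Matrix.of fun k k' =>
    4 * covariance (fun ω => marginalCDF P Y k (Y ω k)) (fun ω => marginalCDF P Y k' (Y ω k')) P

/-- The `χ²` distribution with `K` degrees of freedom: the law of the sum of the squares of `K`
independent standard Gaussian variables. -/
def chiSquared (K : ℕ) : Measure ℝ :=
  (Measure.pi (fun _ : Fin K => gaussianReal 0 1)).map (fun z => ∑ k, z k ^ 2)

instance isProbabilityMeasure_chiSquared (K : ℕ) : IsProbabilityMeasure (chiSquared K) :=
  Measure.isProbabilityMeasure_map
    (Finset.univ.measurable_fun_sum fun k _ => (measurable_pi_apply k).pow_const 2).aemeasurable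

end MultivariateWilcoxon

end

/-! The proof is a Hoeffding projection followed by Slutsky. For a continuous c.d.f. `F`, the sign
kernel `1(x ≤ y) - 1(y ≤ x)` has projection `2 F(y) - 2 F(x)`, and what is left (`degenerateKernel`)
integrates to zero in each argument. Its values at different pairs `(i, j)` are therefore
orthogonal, so the double sum has second moment at most `9 n₁ (n - n₁)`; after normalization this is
`9 / n`, and the remainder vanishes in `L¹` (`integral_abs_wilcoxonVector_sub_projectionVector_le`).

The projection is a weighted sum of the i.i.d. centered scores `2 F_k(X_{i,k}) - 1`, with one
constant weight per sample. The one-dimensional central limit theorem applies to each block; the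
blocks contribute the fractions `1 - t₁` and `t₁` of the variance, so `t₁` drops out of the limit.
Linear combinations of coordinates give the Gaussian limit with covariance `Σ`
(`tendstoInDistribution_projectionVector`).

For `Σ̂_n`, replacing the empirical c.d.f. by `F_k` at the data points costs `O(n^{-1/2})` in `L¹`,
and an `L²` law of large numbers does the rest (`tendstoInMeasure_empiricalCovMatrix`). Inversion is
continuous at `Σ`, so the pair formed by the vector and `Σ̂_n⁻¹` converges, and the quadratic form
passes to the limit. Writing the Gaussian limit as `Σ^{1/2} z` with `z` standard turns the form into
`∑ z_k²` (`map_quadraticForm_multivariateGaussian`). -/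

namespace MultivariateWilcoxon

/-! ### The sign kernel and its projection -/

section Kernel

variable (μ : Measure ℝ)

/-- The antisymmetric kernel of the Mann-Whitney statistic. -/
noncomputable def signKernel (x y : ℝ) : ℝ := (if x ≤ y then 1 else 0) - (if y ≤ x then 1 else 0)

lemma signKernel_swap (x y : ℝ) : signKernel y x = -signKernel x y := by
  simp [signKernel]

lemma abs_signKernel_le (x y : ℝ) : |signKernel x y| ≤ 1 := by
  unfold signKernel; split_ifs <;> norm_num

lemma measurable_indicator_le : Measurable fun p : ℝ × ℝ => if p.1 ≤ p.2 then (1 : ℝ) else 0 :=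
  Measurable.ite (measurableSet_le measurable_fst measurable_snd) measurable_const measurable_const

lemma measurable_signKernel : Measurable fun p : ℝ × ℝ => signKernel p.1 p.2 :=
  measurable_indicator_le.sub (measurable_indicator_le.comp measurable_swap)

/-- The sign kernel minus its projection. -/
noncomputable def degenerateKernel (x y : ℝ) : ℝ := signKernel x y - 2 * cdf μ y + 2 * cdf μ x

/-- The centered indicator kernel of the empirical c.d.f. -/
noncomputable def cdfKernel (x y : ℝ) : ℝ := (if x ≤ y then 1 else 0) - cdf μ y

lemma measurable_cdf : Measurable (cdf μ) := (monotone_cdf μ).measurable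

lemma measurable_degenerateKernel : Measurable fun p : ℝ × ℝ => degenerateKernel μ p.1 p.2 :=
  (measurable_signKernel.sub (((measurable_cdf μ).comp measurable_snd).const_mul 2)).add
    (((measurable_cdf μ).comp measurable_fst).const_mul 2)

lemma measurable_cdfKernel : Measurable fun p : ℝ × ℝ => cdfKernel μ p.1 p.2 :=
  measurable_indicator_le.sub ((measurable_cdf μ).comp measurable_snd)

lemma degenerateKernel_swap (x y : ℝ) : degenerateKernel μ y x = -degenerateKernel μ x y := by
  rw [degenerateKernel, degenerateKernel, signKernel_swap]; ring

lemma abs_degenerateKernel_le (x y : ℝ) : |degenerateKernel μ x y| ≤ 3 := by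
  have h := abs_le.1 (abs_signKernel_le x y)
  have h1 := cdf_nonneg μ x
  have h2 := cdf_le_one μ x
  have h3 := cdf_nonneg μ y
  have h4 := cdf_le_one μ y
  rw [degenerateKernel, abs_le]
  constructor <;> linarith

lemma abs_cdfKernel_le (x y : ℝ) : |cdfKernel μ x y| ≤ 1 := by
  have h3 := cdf_nonneg μ y
  have h4 := cdf_le_one μ y
  rw [cdfKernel, abs_le]
  split_ifs <;> constructor <;> linarith

variable [IsProbabilityMeasure μ]

lemma integrable_of_measurable_of_abs_le {α : Type*} [MeasurableSpace α] {ν : Measure α}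
    [IsFiniteMeasure ν] {f : α → ℝ} (hf : Measurable f) {C : ℝ} (hC : ∀ x, |f x| ≤ C) :
    Integrable f ν :=
  Integrable.of_bound hf.aestronglyMeasurable C (Eventually.of_forall hC)

lemma integrable_indicator_le (y : ℝ) : Integrable (fun x : ℝ => if x ≤ y then (1 : ℝ) else 0) μ :=
  integrable_of_measurable_of_abs_le
    (measurable_indicator_le.comp (measurable_id.prodMk measurable_const))
    (C := 1) (fun x => by split_ifs <;> simp)

lemma integrable_indicator_ge (y : ℝ) : Integrable (fun x : ℝ => if y ≤ x then (1 : ℝ) else 0) μ :=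
  integrable_of_measurable_of_abs_le
    (measurable_indicator_le.comp (measurable_const.prodMk measurable_id))
    (C := 1) (fun x => by split_ifs <;> simp)

lemma integral_indicator_le (y : ℝ) : ∫ x, (if x ≤ y then (1 : ℝ) else 0) ∂μ = cdf μ y := by
  rw [cdf_eq_real, ← integral_indicator_one measurableSet_Iic]
  rfl

lemma integrable_cdf : Integrable (fun x => cdf μ x) μ :=
  integrable_of_measurable_of_abs_le (measurable_cdf μ) (C := 1) fun x => by
    rw [abs_of_nonneg (cdf_nonneg μ x)]; exact cdf_le_one μ x

lemma integral_cdfKernel (y : ℝ) : ∫ x, cdfKernel μ x y ∂μ = 0 := by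
  simp only [cdfKernel]
  rw [integral_sub (integrable_indicator_le μ y) (integrable_const _), integral_indicator_le]
  simp

variable {μ}

lemma measure_singleton_of_continuous_cdf (hμ : Continuous (cdf μ)) (a : ℝ) : μ {a} = 0 := by
  rw [← measure_cdf μ, StieltjesFunction.measure_singleton,
    hμ.continuousAt.continuousWithinAt.leftLim_eq]
  simp

lemma integral_indicator_ge (hμ : Continuous (cdf μ)) (y : ℝ) :
    ∫ x, (if y ≤ x then (1 : ℝ) else 0) ∂μ = 1 - cdf μ y := by
  have h1 : ∫ x, (if y ≤ x then (1 : ℝ) else 0) ∂μ = μ.real (Set.Ici y) := by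
    rw [← integral_indicator_one measurableSet_Ici]; rfl
  have : NullSingletonClass μ := ⟨measure_singleton_of_continuous_cdf hμ⟩
  rw [h1, cdf_eq_real, ← measureReal_congr (Ioi_ae_eq_Ici (μ := μ) (a := y)), ← Set.compl_Iic,
    probReal_compl_eq_one_sub measurableSet_Iic]

lemma integral_signKernel (hμ : Continuous (cdf μ)) (y : ℝ) :
    ∫ x, signKernel x y ∂μ = 2 * cdf μ y - 1 := by
  simp only [signKernel]
  rw [integral_sub (integrable_indicator_le μ y) (integrable_indicator_ge μ y),
    integral_indicator_le, integral_indicator_ge hμ]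
  ring

/-- By antisymmetry and Fubini the double integral of `signKernel` equals its own negative, hence is
zero; integrating one variable first shows that it is also `2 ∫ F - 1`. -/
lemma integral_cdf (hμ : Continuous (cdf μ)) : ∫ x, cdf μ x ∂μ = 1 / 2 := by
  have hswap : ∫ y, ∫ x, signKernel x y ∂μ ∂μ = ∫ x, ∫ y, signKernel x y ∂μ ∂μ :=
    integral_integral_swap (f := fun y x => signKernel x y)
      (integrable_of_measurable_of_abs_le (measurable_signKernel.comp measurable_swap)
        (C := 1) fun p => abs_signKernel_le _ _)
  have hneg : ∫ x, ∫ y, signKernel x y ∂μ ∂μ = -∫ y, ∫ x, signKernel x y ∂μ ∂μ := by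
    simp_rw [← integral_neg, ← signKernel_swap]
  have hG : ∫ y, ∫ x, signKernel x y ∂μ ∂μ = 2 * ∫ x, cdf μ x ∂μ - 1 := by
    simp_rw [integral_signKernel hμ]
    rw [integral_sub ((integrable_cdf μ).const_mul 2) (integrable_const _), integral_const_mul]
    simp
  linarith

/-- The terms cancel as `(2 F(y) - 1) - 2 F(y) + 2 · (1/2)`. Degeneracy in the other argument
follows by antisymmetry. -/
lemma integral_degenerateKernel (hμ : Continuous (cdf μ)) (y : ℝ) :
    ∫ x, degenerateKernel μ x y ∂μ = 0 := by
  have hi : Integrable (fun x => signKernel x y) μ :=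
    (integrable_indicator_le μ y).sub (integrable_indicator_ge μ y)
  simp only [degenerateKernel]
  rw [integral_add (f := fun x => signKernel x y - 2 * cdf μ y) (hi.sub (integrable_const _))
      ((integrable_cdf μ).const_mul 2),
    integral_sub hi (integrable_const _), integral_const_mul _ (fun x => cdf μ x),
    integral_signKernel hμ, integral_cdf hμ]
  simp

end Kernel

/-! ### Orthogonal sums of bounded random variables -/

section Orthogonal

variable {Ω : Type*} [MeasurableSpace Ω] {P : Measure Ω}

lemma tendstoInMeasure_pi {ι : Type*} [Fintype ι] {E : ι → Type*} [∀ i, PseudoMetricSpace (E i)]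
    {Z : ℕ → Ω → ∀ i, E i} {Y : Ω → ∀ i, E i}
    (h : ∀ i, TendstoInMeasure P (fun n ω => Z n ω i) atTop (fun ω => Y ω i)) :
    TendstoInMeasure P Z atTop Y := by
  simp only [tendstoInMeasure_iff_dist] at h ⊢
  intro ε hε
  have hsum := tendsto_finsetSum (Finset.univ : Finset ι) fun i _ => h i ε hε
  rw [Finset.sum_const_zero] at hsum
  refine tendsto_of_tendsto_of_tendsto_of_le_of_le tendsto_const_nhds hsum
    (fun n => zero_le) fun n => ?_
  refine (measure_mono ?_).trans (measure_biUnion_finset_le Finset.univ _)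
  intro ω hω
  simp only [Finset.mem_univ, Set.iUnion_true, Set.mem_iUnion, Set.mem_ofPred_eq] at hω ⊢
  by_contra! hcon
  exact absurd ((dist_pi_lt_iff hε).2 hcon) (not_lt.2 hω)

lemma tendstoInMeasure_comp_of_continuousAt {E F : Type*} [PseudoMetricSpace E]
    [PseudoMetricSpace F] {Y : ℕ → Ω → E} {c : E} (h : TendstoInMeasure P Y atTop fun _ => c)
    {f : E → F} (hf : ContinuousAt f c) :
    TendstoInMeasure P (fun n ω => f (Y n ω)) atTop fun _ => f c := by
  simp only [tendstoInMeasure_iff_dist] at h ⊢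
  intro ε hε
  obtain ⟨δ, hδ, hfδ⟩ := Metric.continuousAt_iff.1 hf ε hε
  refine tendsto_of_tendsto_of_tendsto_of_le_of_le tendsto_const_nhds (h δ hδ)
    (fun n => zero_le) fun n => measure_mono fun ω hω => ?_
  by_contra hcon
  exact absurd (hfδ (not_le.1 hcon)) (not_lt.2 hω)

variable [IsProbabilityMeasure P]

/-- Fubini, with `ξ l` integrated first: it is independent of the other three variables jointly. The
indices `a`, `b`, `c` may coincide, so this covers every product of two kernels in which some index
occurs only once. -/
lemma integral_eq_zero_of_degenerate {ξ : ℕ → Ω → ℝ} (hξ : ∀ i, Measurable (ξ i))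
    (hind : iIndepFun ξ P) {a b c l : ℕ} (ha : a ≠ l) (hb : b ≠ l) (hc : c ≠ l)
    {H : ℝ × ℝ × ℝ → ℝ → ℝ} (hH : Measurable fun p : (ℝ × ℝ × ℝ) × ℝ => H p.1 p.2) {C : ℝ}
    (hC : ∀ y x, |H y x| ≤ C) (h0 : ∀ y, ∫ x, H y x ∂(P.map (ξ l)) = 0) :
    ∫ ω, H (ξ a ω, ξ b ω, ξ c ω) (ξ l ω) ∂P = 0 := by
  have hS := hind.indepFun_finset {a, b, c} {l} (by simp [ha.symm, hb.symm, hc.symm]) hξ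
  have hY : Measurable fun ω => (ξ a ω, ξ b ω, ξ c ω) := by fun_prop
  have hi : IndepFun (fun ω => (ξ a ω, ξ b ω, ξ c ω)) (ξ l) P :=
    hS.comp (φ := fun v : ({a, b, c} : Finset ℕ) → ℝ =>
        (v ⟨a, by simp⟩, v ⟨b, by simp⟩, v ⟨c, by simp⟩))
      (ψ := fun v : ({l} : Finset ℕ) → ℝ => v ⟨l, by simp⟩) (by fun_prop) (by fun_prop)
  have := Measure.isProbabilityMeasure_map (μ := P) hY.aemeasurable
  have := Measure.isProbabilityMeasure_map (μ := P) (hξ l).aemeasurable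
  have hm : ∫ ω, H (ξ a ω, ξ b ω, ξ c ω) (ξ l ω) ∂P = ∫ p : (ℝ × ℝ × ℝ) × ℝ, H p.1 p.2
      ∂(P.map fun ω => ((ξ a ω, ξ b ω, ξ c ω), ξ l ω)) := by
    rw [integral_map (hY.prodMk (hξ l)).aemeasurable hH.aestronglyMeasurable]
  rw [hm, (indepFun_iff_map_prod_eq_prod_map_map hY.aemeasurable (hξ l).aemeasurable).1 hi,
    integral_prod _ (integrable_of_measurable_of_abs_le hH fun p => hC _ _)]
  simp [h0]

lemma integral_sq_sum_le_of_orthogonal {ι : Type*} (s : Finset ι) {Z : ι → Ω → ℝ}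
    (hZ : ∀ p ∈ s, Measurable (Z p)) {C : ℝ} (hC : ∀ p ∈ s, ∀ ω, |Z p ω| ≤ C)
    (horth : ∀ p ∈ s, ∀ q ∈ s, p ≠ q → ∫ ω, Z p ω * Z q ω ∂P = 0) :
    ∫ ω, (∑ p ∈ s, Z p ω) ^ 2 ∂P ≤ C ^ 2 * s.card := by
  have hi : ∀ p ∈ s, ∀ q ∈ s, Integrable (fun ω => Z p ω * Z q ω) P := fun p hp q hq =>
    integrable_of_measurable_of_abs_le ((hZ p hp).mul (hZ q hq)) (C := C * C) fun ω => by
      rw [abs_mul]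
      exact mul_le_mul (hC p hp ω) (hC q hq ω) (abs_nonneg _) ((abs_nonneg _).trans (hC p hp ω))
  simp_rw [sq (∑ p ∈ s, Z p _), Finset.sum_mul_sum]
  rw [integral_finsetSum _ fun p hp => integrable_finsetSum _ fun q hq => hi p hp q hq]
  calc _ = ∑ p ∈ s, ∫ ω, Z p ω * Z p ω ∂P := by
        refine Finset.sum_congr rfl fun p hp => ?_
        rw [integral_finsetSum _ fun q hq => hi p hp q hq]
        exact Finset.sum_eq_single_of_mem p hp fun q hq hqp => horth p hp q hq hqp.symm
    _ ≤ ∑ p ∈ s, C ^ 2 := by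
        refine Finset.sum_le_sum fun p hp => ?_
        calc _ ≤ ∫ _, C ^ 2 ∂P := integral_mono (hi p hp p hp) (integrable_const _) fun ω => by
              simpa [sq] using sq_le_sq' (abs_le.1 (hC p hp ω)).1 (abs_le.1 (hC p hp ω)).2
          _ = C ^ 2 := by simp
    _ = C ^ 2 * s.card := by simp [mul_comm]

/-- The variance of `|Z|` is nonnegative. -/
lemma integral_abs_le_sqrt {Z : Ω → ℝ} (hZ : MemLp Z 2 P) {b : ℝ}
    (hb : ∫ ω, Z ω ^ 2 ∂P ≤ b) : ∫ ω, |Z ω| ∂P ≤ √b := by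
  refine Real.le_sqrt_of_sq_le ?_
  have h := variance_nonneg |Z| P
  rw [variance_eq_sub hZ.abs] at h
  simp only [Pi.pow_apply, Pi.abs_apply, sq_abs] at h
  linarith

lemma memLp_of_measurable_of_abs_le {Z : Ω → ℝ} (hZ : Measurable Z) {C : ℝ}
    (hC : ∀ ω, |Z ω| ≤ C) : MemLp Z 2 P :=
  MemLp.of_bound hZ.aestronglyMeasurable C (Eventually.of_forall hC)

lemma tendstoInMeasure_of_integral_norm_le {E : Type*} [NormedAddCommGroup E]
    {Z : ℕ → Ω → E} {Y : Ω → E} (hZ : ∀ n, Integrable (fun ω => Z n ω - Y ω) P) {b : ℕ → ℝ}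
    (hb : ∀ᶠ n in atTop, ∫ ω, ‖Z n ω - Y ω‖ ∂P ≤ b n) (hlim : Tendsto b atTop (𝓝 0)) :
    TendstoInMeasure P Z atTop Y := by
  rw [tendstoInMeasure_iff_measureReal_norm]
  intro ε hε
  have hlim' : Tendsto (fun n => b n / ε) atTop (𝓝 0) := by simpa using hlim.div_const ε
  refine tendsto_of_tendsto_of_tendsto_of_le_of_le' tendsto_const_nhds hlim'
    (Eventually.of_forall fun n => measureReal_nonneg) ?_
  filter_upwards [hb] with n hn
  rw [le_div_iff₀ hε, mul_comm]
  exact (mul_meas_ge_le_integral_of_nonneg (Eventually.of_forall fun ω => norm_nonneg _)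
    (hZ n).norm ε).trans hn

lemma tendsto_measure_mem_of_tendstoInMeasure {E : Type*} [PseudoMetricSpace E] {Y : ℕ → Ω → E}
    {c : E} (h : TendstoInMeasure P Y atTop fun _ => c) {s : Set E} (hs : s ∈ 𝓝 c) :
    Tendsto (fun n => P {ω | Y n ω ∈ s}) atTop (𝓝 1) := by
  simp only [tendstoInMeasure_iff_dist] at h
  obtain ⟨δ, hδ, hδs⟩ := Metric.mem_nhds_iff.1 hs
  have hlim : Tendsto (fun n => 1 - P {ω | δ ≤ dist (Y n ω) c}) atTop (𝓝 1) := by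
    simpa using ENNReal.Tendsto.sub tendsto_const_nhds (h δ hδ) (Or.inl ENNReal.one_ne_top)
  refine tendsto_of_tendsto_of_tendsto_of_le_of_le hlim tendsto_const_nhds (fun n => ?_)
    (fun n => prob_le_one)
  rw [tsub_le_iff_right, ← measure_univ (μ := P)]
  refine (measure_mono fun ω _ => ?_).trans (measure_union_le _ _)
  by_cases hω : δ ≤ dist (Y n ω) c
  · exact Or.inr hω
  · exact Or.inl (hδs (not_le.1 hω))

end Orthogonal

/-! ### Moment bounds for the Hoeffding remainder and the empirical c.d.f. -/

section Moments

variable {Ω : Type*} [MeasurableSpace Ω] {P : Measure Ω} [IsProbabilityMeasure P]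
  {μ : Measure ℝ} [IsProbabilityMeasure μ] {ξ : ℕ → Ω → ℝ}

lemma measurable_degenerateKernel_comp (μ : Measure ℝ) {α : Type*} [MeasurableSpace α]
    {f g : α → ℝ} (hf : Measurable f) (hg : Measurable g) :
    Measurable fun a => degenerateKernel μ (f a) (g a) :=
  (measurable_degenerateKernel μ).comp (hf.prodMk hg)

lemma measurable_cdfKernel_comp (μ : Measure ℝ) {α : Type*} [MeasurableSpace α]
    {f g : α → ℝ} (hf : Measurable f) (hg : Measurable g) :
    Measurable fun a => cdfKernel μ (f a) (g a) :=
  (measurable_cdfKernel μ).comp (hf.prodMk hg)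

/-- Two different pairs differ in some index, and that index occurs nowhere else in the product
because first-sample and second-sample indices never meet. Integrating it out kills the cross term,
so only the diagonal, bounded by `3 ^ 2` per pair, survives. -/
lemma integral_sq_sum_degenerateKernel_le (hξ : ∀ i, Measurable (ξ i)) (hind : iIndepFun ξ P)
    (hlaw : ∀ i, P.map (ξ i) = μ) (hμ : Continuous (cdf μ)) (m n : ℕ) :
    ∫ ω, (∑ i ∈ Finset.range m, ∑ j ∈ Finset.Ico m n, degenerateKernel μ (ξ i ω) (ξ j ω)) ^ 2 ∂P
      ≤ 9 * (m * (n - m : ℕ)) := by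
  have hb : ∀ p q : ℝ × ℝ, |degenerateKernel μ p.1 p.2 * degenerateKernel μ q.1 q.2| ≤ 3 * 3 :=
    fun p q => by
      rw [abs_mul]
      exact mul_le_mul (abs_degenerateKernel_le μ _ _) (abs_degenerateKernel_le μ _ _)
        (abs_nonneg _) (by norm_num)
  have h := integral_sq_sum_le_of_orthogonal (P := P) (Finset.range m ×ˢ Finset.Ico m n)
    (Z := fun p ω => degenerateKernel μ (ξ p.1 ω) (ξ p.2 ω)) (C := 3)
    (fun p _ => measurable_degenerateKernel_comp μ (hξ _) (hξ _))
    (fun p _ ω => abs_degenerateKernel_le μ _ _) ?_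
  · simp_rw [Finset.sum_product] at h
    refine h.trans (le_of_eq ?_)
    simp
    norm_num
  rintro ⟨i, j⟩ hp ⟨i', j'⟩ hq hne
  simp only [Finset.mem_product, Finset.mem_range, Finset.mem_Ico] at hp hq
  by_cases hi : i = i'
  · have hj : j ≠ j' := fun hj => hne (by rw [hi, hj])
    refine integral_eq_zero_of_degenerate hξ hind (a := i) (b := i') (c := j') (l := j)
      (H := fun y x => degenerateKernel μ y.1 x * degenerateKernel μ y.2.1 y.2.2)
      (by omega) (by omega) (by omega) ?_ (fun y x => hb (y.1, x) y.2) fun y => ?_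
    · exact (measurable_degenerateKernel_comp μ (by fun_prop) (by fun_prop)).mul
        (measurable_degenerateKernel_comp μ (by fun_prop) (by fun_prop))
    -- The isolated index sits in the second slot; antisymmetry moves it to the first, where
    -- degeneracy is available.
    · simp_rw [degenerateKernel_swap μ _ y.1]
      rw [integral_mul_const, integral_neg, hlaw, integral_degenerateKernel hμ]
      simp
  · refine integral_eq_zero_of_degenerate hξ hind (a := j) (b := i') (c := j') (l := i)
      (H := fun y x => degenerateKernel μ x y.1 * degenerateKernel μ y.2.1 y.2.2)
      (by omega) (by omega) (by omega) ?_ (fun y x => hb (x, y.1) y.2) fun y => ?_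
    · exact (measurable_degenerateKernel_comp μ (by fun_prop) (by fun_prop)).mul
        (measurable_degenerateKernel_comp μ (by fun_prop) (by fun_prop))
    · rw [integral_mul_const, hlaw, integral_degenerateKernel hμ, zero_mul]

lemma integral_cdfKernel_mul_cdfKernel_of_ne (hξ : ∀ i, Measurable (ξ i)) (hind : iIndepFun ξ P)
    (hlaw : ∀ i, P.map (ξ i) = μ) {i j l : ℕ} (hj : j ≠ l) (hi : i ≠ l) :
    ∫ ω, cdfKernel μ (ξ j ω) (ξ i ω) * cdfKernel μ (ξ l ω) (ξ i ω) ∂P = 0 := by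
  refine integral_eq_zero_of_degenerate hξ hind (a := j) (b := i) (c := i) (l := l)
    (H := fun y x => cdfKernel μ y.1 y.2.1 * cdfKernel μ x y.2.1) (C := 1 * 1)
    hj hi hi ?_ (fun y x => ?_) fun y => ?_
  · exact (measurable_cdfKernel_comp μ (by fun_prop) (by fun_prop)).mul
      (measurable_cdfKernel_comp μ (by fun_prop) (by fun_prop))
  · rw [abs_mul]
    exact mul_le_mul (abs_cdfKernel_le μ _ _) (abs_cdfKernel_le μ _ _) (abs_nonneg _) zero_le_one
  · rw [integral_const_mul, hlaw, integral_cdfKernel, mul_zero]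

/-- The evaluation point `ξ i` is itself one of the variables, so the summands are not independent.
Still, of two distinct indices `j`, `l` at most one equals `i`, and the other can be integrated out.
-/
lemma integral_sq_sum_cdfKernel_le (hξ : ∀ i, Measurable (ξ i)) (hind : iIndepFun ξ P)
    (hlaw : ∀ i, P.map (ξ i) = μ) (n i : ℕ) :
    ∫ ω, (∑ j ∈ Finset.range n, cdfKernel μ (ξ j ω) (ξ i ω)) ^ 2 ∂P ≤ n := by
  have h := integral_sq_sum_le_of_orthogonal (P := P) (Finset.range n)
    (Z := fun j ω => cdfKernel μ (ξ j ω) (ξ i ω)) (C := 1)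
    (fun p _ => measurable_cdfKernel_comp μ (hξ _) (hξ _))
    (fun p _ ω => abs_cdfKernel_le μ _ _) ?_
  · simpa using h
  intro j _ l _ hjl
  by_cases hi : i = l
  · simp_rw [mul_comm (cdfKernel μ (ξ j _) _)]
    exact integral_cdfKernel_mul_cdfKernel_of_ne hξ hind hlaw hjl.symm (by omega)
  · exact integral_cdfKernel_mul_cdfKernel_of_ne hξ hind hlaw hjl hi

/-- This mean error at a single data point, bounded uniformly in `i`, takes the place of a uniform
Glivenko–Cantelli bound. -/
lemma integral_abs_empirical_sub_cdf_le (hξ : ∀ i, Measurable (ξ i)) (hind : iIndepFun ξ P)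
    (hlaw : ∀ i, P.map (ξ i) = μ) {n : ℕ} (hn : n ≠ 0) (i : ℕ) :
    ∫ ω, |(n : ℝ)⁻¹ * (∑ j ∈ Finset.range n, if ξ j ω ≤ ξ i ω then (1 : ℝ) else 0)
      - cdf μ (ξ i ω)| ∂P ≤ √((n : ℝ)⁻¹) := by
  have hn' : (n : ℝ) ≠ 0 := Nat.cast_ne_zero.2 hn
  have heq : ∀ ω, (n : ℝ)⁻¹ * (∑ j ∈ Finset.range n, if ξ j ω ≤ ξ i ω then (1 : ℝ) else 0)
      - cdf μ (ξ i ω) = (n : ℝ)⁻¹ * ∑ j ∈ Finset.range n, cdfKernel μ (ξ j ω) (ξ i ω) := by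
    intro ω
    simp only [cdfKernel, Finset.sum_sub_distrib, Finset.sum_const, Finset.card_range,
      nsmul_eq_mul]
    field_simp
  simp_rw [heq]
  refine integral_abs_le_sqrt ?_ ?_
  · have h : MemLp (fun ω => ∑ j ∈ Finset.range n, cdfKernel μ (ξ j ω) (ξ i ω)) 2 P :=
      memLp_finsetSum _ fun j _ => memLp_of_measurable_of_abs_le
        (measurable_cdfKernel_comp μ (hξ _) (hξ _)) fun ω => abs_cdfKernel_le μ _ _
    exact h.const_mul _
  · simp_rw [mul_pow]
    rw [integral_const_mul]
    calc _ ≤ ((n : ℝ)⁻¹) ^ 2 * n := mul_le_mul_of_nonneg_left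
          (integral_sq_sum_cdfKernel_le hξ hind hlaw n i) (by positivity)
      _ = (n : ℝ)⁻¹ := by field_simp

/-- The Hoeffding projection of `wilcoxonVector`, where `F k` is the `k`-th marginal c.d.f. -/
noncomputable def projectionVector {K : ℕ} (F : Fin K → ℝ → ℝ) (n n₁ : ℕ) (x : ℕ → Fin K → ℝ) :
    Fin K → ℝ := fun k =>
  1 / √((n : ℝ) * (n₁ : ℝ) * ((n : ℝ) - (n₁ : ℝ))) *
    ∑ i ∈ Finset.range n₁, ∑ j ∈ Finset.Ico n₁ n, (2 * F k (x j k) - 2 * F k (x i k))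

lemma wilcoxonVector_sub_projectionVector {K : ℕ} (μ : Fin K → Measure ℝ) (n n₁ : ℕ)
    (x : ℕ → Fin K → ℝ) (k : Fin K) :
    wilcoxonVector n n₁ x k - projectionVector (fun k => cdf (μ k)) n n₁ x k =
      1 / √((n : ℝ) * (n₁ : ℝ) * ((n : ℝ) - (n₁ : ℝ))) *
        ∑ i ∈ Finset.range n₁, ∑ j ∈ Finset.Ico n₁ n,
          degenerateKernel (μ k) (x i k) (x j k) := by
  rw [wilcoxonVector, projectionVector, ← mul_sub, ← Finset.sum_sub_distrib]
  congr 1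
  refine Finset.sum_congr rfl fun i _ => ?_
  rw [← Finset.sum_sub_distrib]
  refine Finset.sum_congr rfl fun j _ => ?_
  rw [degenerateKernel, signKernel]
  ring

variable {K : ℕ} {X : ℕ → Ω → Fin K → ℝ} {ν : Fin K → Measure ℝ}

lemma memLp_wilcoxonVector_sub_projectionVector (hX : ∀ i, Measurable (X i)) (n n₁ : ℕ)
    (k : Fin K) :
    MemLp (fun ω => wilcoxonVector n n₁ (fun i => X i ω) k -
      projectionVector (fun k => cdf (ν k)) n n₁ (fun i => X i ω) k) 2 P := by
  simp_rw [wilcoxonVector_sub_projectionVector]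
  have h : MemLp (fun ω => ∑ i ∈ Finset.range n₁, ∑ j ∈ Finset.Ico n₁ n,
      degenerateKernel (ν k) (X i ω k) (X j ω k)) 2 P :=
    memLp_finsetSum _ fun i _ => memLp_finsetSum _ fun j _ => memLp_of_measurable_of_abs_le
      (measurable_degenerateKernel_comp _ (measurable_pi_apply k |>.comp (hX i))
        (measurable_pi_apply k |>.comp (hX j))) fun ω => abs_degenerateKernel_le _ _ _
  exact h.const_mul _

variable [∀ k, IsProbabilityMeasure (ν k)]

lemma integral_abs_wilcoxonVector_sub_projectionVector_le (hX : ∀ i, Measurable (X i))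
    (hind : iIndepFun X P) (hlaw : ∀ i k, P.map (fun ω => X i ω k) = ν k)
    (hν : ∀ k, Continuous (cdf (ν k))) {n n₁ : ℕ} (h0 : 0 < n₁) (hn : n₁ < n) (k : Fin K) :
    ∫ ω, |wilcoxonVector n n₁ (fun i => X i ω) k -
      projectionVector (fun k => cdf (ν k)) n n₁ (fun i => X i ω) k| ∂P ≤ √(9 / n) := by
  refine integral_abs_le_sqrt (memLp_wilcoxonVector_sub_projectionVector hX n n₁ k) ?_
  simp_rw [wilcoxonVector_sub_projectionVector, mul_pow]
  rw [integral_const_mul]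
  have h1 : (0 : ℝ) < n₁ := by exact_mod_cast h0
  have h2 : (0 : ℝ) < (n : ℝ) - n₁ := sub_pos.2 (by exact_mod_cast hn)
  have h3 : (0 : ℝ) < n := by linarith
  have hle := integral_sq_sum_degenerateKernel_le (P := P) (ξ := fun i ω => X i ω k)
    (fun i => measurable_pi_apply k |>.comp (hX i))
    (hind.comp (fun _ x => x k) fun _ => measurable_pi_apply k) (fun i => hlaw i k) (hν k) n₁ n
  rw [Nat.cast_sub hn.le] at hle
  refine (mul_le_mul_of_nonneg_left hle (by positivity)).trans (le_of_eq ?_)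
  rw [div_pow, Real.sq_sqrt (by positivity)]
  field_simp

end Moments

/-! ### Central limit theorem for the projection -/

section CentralLimit

variable {Ω : Type*} [MeasurableSpace Ω] {P : Measure Ω} {K : ℕ} {X : ℕ → Ω → Fin K → ℝ}

lemma charFun_map_weighted_sum {g : ℕ → Ω → ℝ} (hg : ∀ i, Measurable (g i))
    (hind : iIndepFun g P) (hident : ∀ i, IdentDistrib (g i) (g 0) P P) (w : ℕ → ℝ) (n : ℕ)
    (t : ℝ) :
    charFun (P.map fun ω => ∑ i ∈ Finset.range n, w i * g i ω) t =
      ∏ i ∈ Finset.range n, charFun (P.map (g 0)) (w i * t) := by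
  have hind' : iIndepFun (fun i ω => w i * g i ω) P :=
    hind.comp (fun i x => w i * x) fun i => by fun_prop
  rw [(hind'.restrict _).charFun_map_fun_finsetSum_eq_prod
    fun i _ => ((hg i).const_mul (w i)).aemeasurable, Finset.prod_apply]
  refine Finset.prod_congr rfl fun i _ => ?_
  rw [charFun_map_mul_comp (hg i).aemeasurable, (hident i).map_eq]

lemma measurable_marginalCDF (Y : Ω → Fin K → ℝ) (k : Fin K) :
    Measurable (marginalCDF P Y k) :=
  measurable_cdf _

lemma abs_marginalCDF_sub_half_le (Y : Ω → Fin K → ℝ) (k : Fin K) (t : ℝ) :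
    |marginalCDF P Y k t - 1 / 2| ≤ 1 / 2 := by
  have h1 := cdf_nonneg (P.map fun ω => Y ω k) t
  have h2 := cdf_le_one (P.map fun ω => Y ω k) t
  rw [marginalCDF, abs_le]
  constructor <;> linarith

variable [IsProbabilityMeasure P]

/-- The power is the characteristic function at `1` of `a n` times a sum of `m n` terms, that is, of
`a n * √(m n)` times the normalized sum. The central limit theorem along `m` and Slutsky with the
deterministic factor tending to `s` give the limit. -/
lemma tendsto_charFun_pow {g : ℕ → Ω → ℝ} (hg : MemLp (g 0) 2 P) (h0 : P[g 0] = 0)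
    (hind : iIndepFun g P) (hident : ∀ i, IdentDistrib (g i) (g 0) P P)
    {m : ℕ → ℕ} (hm : Tendsto m atTop atTop) {a : ℕ → ℝ} {s : ℝ}
    (ha : Tendsto (fun n => a n * √(m n)) atTop (𝓝 s)) :
    Tendsto (fun n => charFun (P.map (g 0)) (a n) ^ m n) atTop
      (𝓝 (Complex.exp (-(Var[g 0; P] * s ^ 2 / 2 : ℝ)))) := by
  have hclt := tendstoInDistribution_inv_sqrt_mul_sum_sub
    (HasLaw.id (μ := gaussianReal 0 Var[g 0; P].toNNReal)) hg hind hident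
  simp only [h0, mul_zero, sub_zero] at hclt
  have hsub : TendstoInDistribution
      (fun n ω => (√(m n))⁻¹ * ∑ k ∈ Finset.range (m n), g k ω) atTop id (fun _ => P)
      (gaussianReal 0 Var[g 0; P].toNNReal) :=
    ⟨fun n => hclt.1 (m n), hclt.2, hclt.3.comp hm⟩
  have hs : TendstoInMeasure P (fun n (_ : Ω) => a n * √(m n)) atTop fun _ => s :=
    tendstoInMeasure_of_tendsto_ae (fun n => aestronglyMeasurable_const)
      (Eventually.of_forall fun _ => ha)
  have hmul := hsub.continuous_comp_prodMk_of_tendstoInMeasure_const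
    (g := fun p : ℝ × ℝ => p.2 * p.1) (by fun_prop) hs (fun n => aemeasurable_const)
  have hchar := ProbabilityMeasure.tendsto_iff_tendsto_charFun.1 hmul.tendsto 1
  simp only [ProbabilityMeasure.coe_mk] at hchar
  have hlim : charFun ((gaussianReal 0 Var[g 0; P].toNNReal).map fun ω => s * id ω) 1 =
      Complex.exp (-(Var[g 0; P] * s ^ 2 / 2 : ℝ)) := by
    rw [charFun_map_mul_comp (by fun_prop), Measure.map_id, charFun_gaussianReal,
      Real.coe_toNNReal _ (variance_nonneg _ _)]
    congr 1
    push_cast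
    ring
  rw [hlim] at hchar
  refine hchar.congr' ?_
  filter_upwards [hm.eventually_gt_atTop 0] with n hn
  have hn' : √(m n : ℝ) ≠ 0 := (Real.sqrt_pos.2 (by exact_mod_cast hn)).ne'
  rw [charFun_map_mul_comp (hsub.1 n), charFun_inv_sqrt_mul_sum hind hident]
  congr 2
  field_simp

/-- The weight of the `i`-th observation in the projection of the two-sample statistic. -/
noncomputable def contrastWeight (n n₁ i : ℕ) : ℝ :=
  1 / √((n : ℝ) * (n₁ : ℝ) * ((n : ℝ) - (n₁ : ℝ))) *
    if i < n₁ then -((n : ℝ) - n₁) else (n₁ : ℝ)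

lemma tendsto_sub_div_one {n₁ : ℕ → ℕ} {t₁ : ℝ}
    (hn₁ : Tendsto (fun n : ℕ => (n₁ n : ℝ) / (n : ℝ)) atTop (𝓝 t₁)) :
    Tendsto (fun n : ℕ => ((n : ℝ) - n₁ n) / (n : ℝ)) atTop (𝓝 (1 - t₁)) := by
  refine (hn₁.const_sub 1).congr' ?_
  filter_upwards [eventually_ne_atTop 0] with n hn
  have : (n : ℝ) ≠ 0 := Nat.cast_ne_zero.2 hn
  field_simp

lemma tendsto_atTop_of_tendsto_div {u : ℕ → ℝ} {t : ℝ} (ht : 0 < t)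
    (hu : Tendsto (fun n : ℕ => u n / (n : ℝ)) atTop (𝓝 t)) : Tendsto u atTop atTop := by
  refine (hu.pos_mul_atTop ht tendsto_natCast_atTop_atTop).congr' ?_
  filter_upwards [eventually_ne_atTop 0] with n hn
  have : (n : ℝ) ≠ 0 := Nat.cast_ne_zero.2 hn
  field_simp

lemma eventually_pos_and_lt {n₁ : ℕ → ℕ} {t₁ : ℝ} (ht₁ : t₁ ∈ Set.Ioo (0 : ℝ) 1)
    (hn₁ : Tendsto (fun n : ℕ => (n₁ n : ℝ) / (n : ℝ)) atTop (𝓝 t₁)) :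
    ∀ᶠ n in atTop, 0 < n₁ n ∧ n₁ n < n := by
  filter_upwards [(tendsto_atTop_of_tendsto_div ht₁.1 hn₁).eventually_gt_atTop 0,
    (tendsto_atTop_of_tendsto_div (sub_pos.2 ht₁.2)
      (tendsto_sub_div_one hn₁)).eventually_gt_atTop 0] with n h1 h2
  exact ⟨by exact_mod_cast h1, by exact_mod_cast sub_pos.1 h2⟩

/-- The weights are constant on each sample, so the characteristic function is a product of two
powers, each handled by `tendsto_charFun_pow`. -/
lemma tendsto_charFun_contrast {g : ℕ → Ω → ℝ} (hg : ∀ i, Measurable (g i))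
    (hg2 : MemLp (g 0) 2 P) (h0 : P[g 0] = 0) (hind : iIndepFun g P)
    (hident : ∀ i, IdentDistrib (g i) (g 0) P P) {n₁ : ℕ → ℕ} {t₁ : ℝ}
    (ht₁ : t₁ ∈ Set.Ioo (0 : ℝ) 1)
    (hn₁ : Tendsto (fun n : ℕ => (n₁ n : ℝ) / (n : ℝ)) atTop (𝓝 t₁)) :
    Tendsto (fun n => charFun (P.map fun ω => ∑ i ∈ Finset.range n,
      contrastWeight n (n₁ n) i * g i ω) 1) atTop
      (𝓝 (Complex.exp (-(Var[g 0; P] / 2 : ℝ)))) := by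
  have hev := eventually_pos_and_lt ht₁ hn₁
  have hm : Tendsto n₁ atTop atTop :=
    tendsto_natCast_atTop_iff.1 (tendsto_atTop_of_tendsto_div ht₁.1 hn₁)
  have hm' : Tendsto (fun n => n - n₁ n) atTop atTop := by
    refine tendsto_natCast_atTop_iff (R := ℝ).1 ?_
    refine (tendsto_atTop_of_tendsto_div (sub_pos.2 ht₁.2) (tendsto_sub_div_one hn₁)).congr' ?_
    filter_upwards [hev] with n hn
    rw [Nat.cast_sub hn.2.le]
  -- First-sample weight times `√n₁` simplifies to `-√((n - n₁) / n)`; the second sample gives `√(n₁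
  -- / n)`.
  have hlim1 : Tendsto (fun n : ℕ => 1 / √((n : ℝ) * (n₁ n : ℝ) * ((n : ℝ) - (n₁ n : ℝ))) *
      -((n : ℝ) - n₁ n) * √(n₁ n)) atTop (𝓝 (-√(1 - t₁))) := by
    refine (tendsto_sub_div_one hn₁).sqrt.neg.congr' ?_
    filter_upwards [hev] with n hn
    have h1 : (0 : ℝ) < n₁ n := by exact_mod_cast hn.1
    have h2 : (0 : ℝ) < (n : ℝ) - n₁ n := sub_pos.2 (by exact_mod_cast hn.2)
    have h3 : (0 : ℝ) < n := by linarith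
    rw [Real.sqrt_mul (by positivity), Real.sqrt_mul h3.le, Real.sqrt_div h2.le]
    have e1 := Real.sqrt_pos.2 h1
    have e2 := Real.sqrt_pos.2 h2
    have e3 := Real.sqrt_pos.2 h3
    field_simp
    rw [Real.sq_sqrt h2.le]
  have hlim2 : Tendsto (fun n : ℕ => 1 / √((n : ℝ) * (n₁ n : ℝ) * ((n : ℝ) - (n₁ n : ℝ))) *
      (n₁ n : ℝ) * √((n - n₁ n : ℕ) : ℝ)) atTop (𝓝 (√t₁)) := by
    refine hn₁.sqrt.congr' ?_
    filter_upwards [hev] with n hn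
    have h1 : (0 : ℝ) < n₁ n := by exact_mod_cast hn.1
    have h2 : (0 : ℝ) < (n : ℝ) - n₁ n := sub_pos.2 (by exact_mod_cast hn.2)
    have h3 : (0 : ℝ) < n := by linarith
    rw [Nat.cast_sub hn.2.le, Real.sqrt_mul (by positivity), Real.sqrt_mul h3.le,
      Real.sqrt_div h1.le]
    have e1 := Real.sqrt_pos.2 h1
    have e2 := Real.sqrt_pos.2 h2
    have e3 := Real.sqrt_pos.2 h3
    field_simp
    rw [Real.sq_sqrt h1.le]
  have hprod := (tendsto_charFun_pow hg2 h0 hind hident hm hlim1).mul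
    (tendsto_charFun_pow hg2 h0 hind hident hm' hlim2)
  -- The variance shares add up as `(1 - t₁) + t₁ = 1`.
  have hval : Complex.exp (-(Var[g 0; P] * (-√(1 - t₁)) ^ 2 / 2 : ℝ)) *
      Complex.exp (-(Var[g 0; P] * (√t₁) ^ 2 / 2 : ℝ)) =
      Complex.exp (-(Var[g 0; P] / 2 : ℝ)) := by
    rw [← Complex.exp_add, neg_sq, Real.sq_sqrt (sub_pos.2 ht₁.2).le, Real.sq_sqrt ht₁.1.le]
    congr 1
    push_cast
    ring
  rw [hval] at hprod
  refine hprod.congr' ?_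
  filter_upwards [hev] with n hn
  rw [charFun_map_weighted_sum hg hind hident, ← Finset.prod_range_mul_prod_Ico _ hn.2.le]
  congr 1
  · rw [Finset.prod_congr rfl fun i hi => by
      rw [contrastWeight, if_pos (Finset.mem_range.1 hi), mul_one]]
    simp
  · rw [Finset.prod_congr rfl fun i hi => by
      rw [contrastWeight, if_neg (not_lt.2 (Finset.mem_Ico.1 hi).1), mul_one]]
    simp

/-- Each first-sample score is counted `n - n₁` times with a minus sign, each second-sample score
`n₁` times. The weights sum to zero, so centering by `-1` is free. -/
lemma projectionVector_eq_sum (F : Fin K → ℝ → ℝ) {n n₁ : ℕ} (hn : n₁ ≤ n)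
    (x : ℕ → Fin K → ℝ) (k : Fin K) :
    projectionVector F n n₁ x k =
      ∑ i ∈ Finset.range n, contrastWeight n n₁ i * (2 * F k (x i k) - 1) := by
  have h1 : ∑ i ∈ Finset.range n₁, contrastWeight n n₁ i * (2 * F k (x i k) - 1) =
      1 / √((n : ℝ) * (n₁ : ℝ) * ((n : ℝ) - (n₁ : ℝ))) *
        (-((n : ℝ) - n₁) * ∑ i ∈ Finset.range n₁, (2 * F k (x i k) - 1)) := by
    rw [Finset.mul_sum, Finset.mul_sum]
    refine Finset.sum_congr rfl fun i hi => ?_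
    rw [contrastWeight, if_pos (Finset.mem_range.1 hi), mul_assoc]
  have h2 : ∑ i ∈ Finset.Ico n₁ n, contrastWeight n n₁ i * (2 * F k (x i k) - 1) =
      1 / √((n : ℝ) * (n₁ : ℝ) * ((n : ℝ) - (n₁ : ℝ))) *
        (n₁ * ∑ i ∈ Finset.Ico n₁ n, (2 * F k (x i k) - 1)) := by
    rw [Finset.mul_sum, Finset.mul_sum]
    refine Finset.sum_congr rfl fun i hi => ?_
    rw [contrastWeight, if_neg (not_lt.2 (Finset.mem_Ico.1 hi).1), mul_assoc]
  rw [← Finset.sum_range_add_sum_Ico _ hn, h1, h2, ← mul_add, projectionVector]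
  congr 1
  simp only [Finset.sum_sub_distrib, Finset.sum_const, Finset.card_range, Nat.card_Ico,
    nsmul_eq_mul, mul_one, Nat.cast_sub hn, ← Finset.mul_sum]
  ring

lemma integral_marginalCDF {Y : Ω → Fin K → ℝ} (hY : Measurable Y)
    (hF : ∀ k, Continuous (marginalCDF P Y k)) (k : Fin K) :
    ∫ ω, marginalCDF P Y k (Y ω k) ∂P = 1 / 2 := by
  have hYk : Measurable fun ω => Y ω k := measurable_pi_apply k |>.comp hY
  have := Measure.isProbabilityMeasure_map (μ := P) hYk.aemeasurable
  rw [← integral_cdf (hF k), integral_map hYk.aemeasurable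
    (measurable_cdf _).aestronglyMeasurable]
  rfl

lemma memLp_marginalCDF {Y : Ω → Fin K → ℝ} (hY : Measurable Y) (k : Fin K) :
    MemLp (fun ω => marginalCDF P Y k (Y ω k)) 2 P :=
  memLp_of_measurable_of_abs_le
    ((measurable_marginalCDF Y k).comp (measurable_pi_apply k |>.comp hY))
    (C := 1) fun ω => by
      rw [marginalCDF, abs_of_nonneg (cdf_nonneg _ _)]; exact cdf_le_one _ _

lemma memLp_centered_marginalCDF {Y : Ω → Fin K → ℝ} (hY : Measurable Y) (l : Fin K → ℝ)
    (k : Fin K) : MemLp (fun ω => l k * (2 * marginalCDF P Y k (Y ω k) - 1)) 2 P :=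
  (((memLp_marginalCDF hY k).const_mul 2).sub (memLp_const 1)).const_mul (l k)

/-- The linear combination of the centered marginal scores with coefficients `l`. -/
noncomputable def score (F : Fin K → ℝ → ℝ) (l : Fin K → ℝ) (y : Fin K → ℝ) : ℝ :=
  ∑ k, l k * (2 * F k (y k) - 1)

lemma measurable_score {F : Fin K → ℝ → ℝ} (hF : ∀ k, Measurable (F k)) (l : Fin K → ℝ) :
    Measurable (score F l) :=
  Finset.measurable_fun_sum _ fun k _ =>
    ((((hF k).comp (measurable_pi_apply k)).const_mul 2).sub_const 1).const_mul (l k)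

lemma memLp_score {Y : Ω → Fin K → ℝ} (hY : Measurable Y) (l : Fin K → ℝ) :
    MemLp (fun ω => score (marginalCDF P Y) l (Y ω)) 2 P :=
  memLp_finsetSum _ fun k _ => memLp_centered_marginalCDF hY l k

lemma integral_score {Y : Ω → Fin K → ℝ} (hY : Measurable Y)
    (hF : ∀ k, Continuous (marginalCDF P Y k)) (l : Fin K → ℝ) :
    ∫ ω, score (marginalCDF P Y) l (Y ω) ∂P = 0 := by
  have hi : ∀ k, Integrable (fun ω => marginalCDF P Y k (Y ω k)) P := fun k =>
    (memLp_marginalCDF hY k).integrable one_le_two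
  simp only [score]
  rw [integral_finsetSum _ fun k _ =>
    (memLp_centered_marginalCDF hY l k).integrable one_le_two]
  refine Finset.sum_eq_zero fun k _ => ?_
  rw [integral_const_mul, integral_sub ((hi k).const_mul 2) (integrable_const 1),
    integral_const_mul, integral_marginalCDF hY hF]
  simp

lemma variance_score {Y : Ω → Fin K → ℝ} (hY : Measurable Y) (l : Fin K → ℝ) :
    Var[fun ω => score (marginalCDF P Y) l (Y ω); P] =
      l ⬝ᵥ (rankCovMatrix P Y).mulVec l := by
  have hm := fun k => memLp_marginalCDF (P := P) hY k
  simp only [score]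
  rw [variance_fun_sum' fun k _ => memLp_centered_marginalCDF hY l k]
  simp only [dotProduct, Matrix.mulVec, rankCovMatrix, Matrix.of_apply, Finset.mul_sum]
  refine Finset.sum_congr rfl fun k _ => Finset.sum_congr rfl fun k' _ => ?_
  rw [covariance_const_mul_left, covariance_const_mul_right,
    covariance_sub_const_left (((hm k).const_mul 2).integrable one_le_two),
    covariance_sub_const_right (((hm k').const_mul 2).integrable one_le_two),
    covariance_const_mul_left, covariance_const_mul_right]
  ring

lemma measurable_projectionVector {F : Fin K → ℝ → ℝ} (hF : ∀ k, Measurable (F k))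
    (hX : ∀ i, Measurable (X i)) (n n₁ : ℕ) :
    Measurable fun ω => projectionVector F n n₁ fun i => X i ω := by
  refine measurable_pi_lambda _ fun k => (Finset.measurable_fun_sum _ fun i _ =>
    Finset.measurable_fun_sum _ fun j _ => ?_).const_mul _
  exact (((hF k).comp (measurable_pi_apply k |>.comp (hX j))).const_mul 2).sub
    (((hF k).comp (measurable_pi_apply k |>.comp (hX i))).const_mul 2)

/-- Cramér–Wold: the characteristic function of the vector at `l` is that of the scalar contrast of
`score _ l` at `1`, and the variance of this score is the quadratic form of `Σ` at `l`. -/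
lemma tendstoInDistribution_projectionVector (hX : ∀ i, Measurable (X i)) (hind : iIndepFun X P)
    (hident : ∀ i, IdentDistrib (X i) (X 0) P P)
    (hF : ∀ k, Continuous (marginalCDF P (X 0) k)) {n₁ : ℕ → ℕ} {t₁ : ℝ}
    (ht₁ : t₁ ∈ Set.Ioo (0 : ℝ) 1)
    (hn₁ : Tendsto (fun n : ℕ => (n₁ n : ℝ) / (n : ℝ)) atTop (𝓝 t₁))
    (hS : (rankCovMatrix P (X 0)).PosSemidef) :
    TendstoInDistribution
      (fun n ω => WithLp.toLp 2 (projectionVector (marginalCDF P (X 0)) n (n₁ n) fun i => X i ω))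
      atTop id (fun _ => P) (multivariateGaussian 0 (rankCovMatrix P (X 0))) := by
  have hT : ∀ n, Measurable fun ω =>
      WithLp.toLp 2 (projectionVector (marginalCDF P (X 0)) n (n₁ n) fun i => X i ω) := fun n =>
    (WithLp.measurable_toLp 2 _).comp
      (measurable_projectionVector (measurable_marginalCDF (X 0)) hX n (n₁ n))
  refine ⟨fun n => (hT n).aemeasurable, aemeasurable_id, ?_⟩
  refine ProbabilityMeasure.tendsto_iff_tendsto_charFun.2 fun l => ?_
  simp only [ProbabilityMeasure.coe_mk, Measure.map_id, charFun_multivariateGaussian hS]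
  have hscore := measurable_score (measurable_marginalCDF (P := P) (X 0)) (WithLp.ofLp l)
  have hlim := tendsto_charFun_contrast
    (g := fun i ω => score (marginalCDF P (X 0)) (WithLp.ofLp l) (X i ω))
    (fun i => hscore.comp (hX i)) (memLp_score (hX 0) _) (integral_score (hX 0) hF _)
    (hind.comp (fun _ => score (marginalCDF P (X 0)) (WithLp.ofLp l)) fun _ => hscore)
    (fun i => (hident i).comp hscore) ht₁ hn₁
  rw [variance_score (hX 0)] at hlim
  convert hlim.congr' ?_ using 2
  · simp
  · filter_upwards [eventually_pos_and_lt ht₁ hn₁] with n hn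
    have hsum : Measurable fun ω => ∑ i ∈ Finset.range n, contrastWeight n (n₁ n) i *
        score (marginalCDF P (X 0)) (WithLp.ofLp l) (X i ω) :=
      Finset.measurable_fun_sum _ fun i _ => (hscore.comp (hX i)).const_mul _
    rw [charFun_apply, charFun_apply, integral_map (hT n).aemeasurable (by fun_prop),
      integral_map hsum.aemeasurable (by fun_prop)]
    refine integral_congr_ae (Eventually.of_forall fun ω => ?_)
    simp only [PiLp.inner_apply, projectionVector_eq_sum _ hn.2.le]
    congr 3
    simp only [score, Finset.mul_sum, RCLike.inner_apply, conj_trivial, one_mul]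
    rw [Finset.sum_comm]
    refine Finset.sum_congr rfl fun k _ => Finset.sum_congr rfl fun i _ => ?_
    ring

end CentralLimit

/-! ### Consistency of the rank-based covariance matrix -/

section Consistency

variable {Ω : Type*} [MeasurableSpace Ω] {P : Measure Ω} {K : ℕ} {X : ℕ → Ω → Fin K → ℝ}

lemma abs_empiricalCDF_sub_half_le (n : ℕ) (x : ℕ → Fin K → ℝ) (k : Fin K) (t : ℝ) :
    |empiricalCDF n x k t - 1 / 2| ≤ 1 / 2 := by
  have h0 : 0 ≤ empiricalCDF n x k t :=
    mul_nonneg (by positivity) (Finset.sum_nonneg fun j _ => by split_ifs <;> norm_num)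
  have h1 : empiricalCDF n x k t ≤ 1 := by
    have hs : ∑ j ∈ Finset.range n, (if x j k ≤ t then (1 : ℝ) else 0) ≤ n := by
      calc _ ≤ ∑ _j ∈ Finset.range n, (1 : ℝ) :=
            Finset.sum_le_sum fun j _ => by split_ifs <;> norm_num
        _ = n := by simp
    exact (mul_le_mul_of_nonneg_left hs (by positivity)).trans inv_mul_le_one
  rw [abs_le]
  constructor <;> linarith

lemma measurable_empiricalCDF (hX : ∀ i, Measurable (X i)) (n i : ℕ) (k : Fin K) :
    Measurable fun ω => empiricalCDF n (fun i => X i ω) k (X i ω k) :=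
  (Finset.measurable_fun_sum _ fun j _ => measurable_indicator_le.comp
    ((measurable_pi_apply k |>.comp (hX j)).prodMk
      (measurable_pi_apply k |>.comp (hX i)))).const_mul _

lemma measurable_empiricalCovMatrix (hX : ∀ i, Measurable (X i)) (n : ℕ) (k k' : Fin K) :
    Measurable fun ω => empiricalCovMatrix n (fun i => X i ω) k k' :=
  (Finset.measurable_fun_sum _ fun i _ =>
    ((measurable_empiricalCDF hX n i k).sub_const _).mul
      ((measurable_empiricalCDF hX n i k').sub_const _)).const_mul _

lemma measurable_wilcoxonVector (hX : ∀ i, Measurable (X i)) (n n₁ : ℕ) :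
    Measurable fun ω => wilcoxonVector n n₁ fun i => X i ω :=
  measurable_pi_lambda _ fun k => (Finset.measurable_fun_sum _ fun i _ =>
    Finset.measurable_fun_sum _ fun j _ => measurable_signKernel.comp
      ((measurable_pi_apply k |>.comp (hX i)).prodMk
        (measurable_pi_apply k |>.comp (hX j)))).const_mul _

lemma abs_mul_sub_mul_le {a b a' b' : ℝ} (hb : |b| ≤ 1 / 2) (ha' : |a'| ≤ 1 / 2) :
    |a * b - a' * b'| ≤ 1 / 2 * (|a - a'| + |b - b'|) := by
  calc |a * b - a' * b'| = |(a - a') * b + a' * (b - b')| := by congr 1; ring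
    _ ≤ |a - a'| * |b| + |a'| * |b - b'| := by
        rw [← abs_mul, ← abs_mul]; exact abs_add_le _ _
    _ ≤ |a - a'| * (1 / 2) + 1 / 2 * |b - b'| := by gcongr
    _ = _ := by ring

/-- The product of two centered marginal scores. -/
noncomputable def scoreProduct (F : Fin K → ℝ → ℝ) (k k' : Fin K) (y : Fin K → ℝ) : ℝ :=
  (F k (y k) - 1 / 2) * (F k' (y k') - 1 / 2)

lemma measurable_scoreProduct {F : Fin K → ℝ → ℝ} (hF : ∀ k, Measurable (F k)) (k k' : Fin K) :
    Measurable (scoreProduct F k k') :=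
  (((hF k).comp (measurable_pi_apply k)).sub_const _).mul
    (((hF k').comp (measurable_pi_apply k')).sub_const _)

lemma abs_scoreProduct_le (Y : Ω → Fin K → ℝ) (k k' : Fin K) (y : Fin K → ℝ) :
    |scoreProduct (marginalCDF P Y) k k' y| ≤ 1 / 4 := by
  rw [scoreProduct, abs_mul]
  calc _ ≤ (1 / 2 : ℝ) * (1 / 2) := mul_le_mul (abs_marginalCDF_sub_half_le Y k _)
        (abs_marginalCDF_sub_half_le Y k' _) (abs_nonneg _) (by norm_num)
    _ = 1 / 4 := by norm_num

lemma abs_empiricalCovMatrix_sub_le (n : ℕ) (x : ℕ → Fin K → ℝ) (Y : Ω → Fin K → ℝ)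
    (k k' : Fin K) :
    |empiricalCovMatrix n x k k' -
        4 / (n : ℝ) * ∑ i ∈ Finset.range n, scoreProduct (marginalCDF P Y) k k' (x i)| ≤
      2 / (n : ℝ) * ∑ i ∈ Finset.range n,
        (|empiricalCDF n x k (x i k) - marginalCDF P Y k (x i k)| +
          |empiricalCDF n x k' (x i k') - marginalCDF P Y k' (x i k')|) := by
  rw [empiricalCovMatrix, Matrix.of_apply, ← mul_sub, ← Finset.sum_sub_distrib, abs_mul,
    abs_of_nonneg (by positivity : (0 : ℝ) ≤ 4 / n)]
  calc _ ≤ 4 / (n : ℝ) * ∑ i ∈ Finset.range n, 1 / 2 *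
        (|empiricalCDF n x k (x i k) - marginalCDF P Y k (x i k)| +
          |empiricalCDF n x k' (x i k') - marginalCDF P Y k' (x i k')|) := by
        refine mul_le_mul_of_nonneg_left ((Finset.abs_sum_le_sum_abs _ _).trans
          (Finset.sum_le_sum fun i _ => ?_)) (by positivity)
        refine (abs_mul_sub_mul_le (abs_empiricalCDF_sub_half_le n x k' _)
          (abs_marginalCDF_sub_half_le Y k _)).trans (le_of_eq ?_)
        congr 3 <;> ring
    _ = _ := by rw [← Finset.mul_sum]; ring

variable [IsProbabilityMeasure P]

lemma rankCovMatrix_apply {Y : Ω → Fin K → ℝ} (hY : Measurable Y)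
    (hF : ∀ k, Continuous (marginalCDF P Y k)) (k k' : Fin K) :
    rankCovMatrix P Y k k' = 4 * ∫ ω, scoreProduct (marginalCDF P Y) k k' (Y ω) ∂P := by
  rw [rankCovMatrix, Matrix.of_apply, covariance, integral_marginalCDF hY hF,
    integral_marginalCDF hY hF]
  rfl

/-- An `L²` weak law: the centered products are independent and bounded by `1/2`, so the second
moment is at most `(4/n)² · n/4 = 4/n`. -/
lemma integral_abs_mean_scoreProduct_sub_le (hX : ∀ i, Measurable (X i)) (hind : iIndepFun X P)
    (hident : ∀ i, IdentDistrib (X i) (X 0) P P)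
    (hF : ∀ k, Continuous (marginalCDF P (X 0) k)) {n : ℕ} (hn : n ≠ 0) (k k' : Fin K) :
    ∫ ω, |4 / (n : ℝ) * ∑ i ∈ Finset.range n, scoreProduct (marginalCDF P (X 0)) k k' (X i ω)
      - rankCovMatrix P (X 0) k k'| ∂P ≤ √(4 / n) := by
  have hn' : (n : ℝ) ≠ 0 := Nat.cast_ne_zero.2 hn
  set φ := scoreProduct (marginalCDF P (X 0)) k k' with hφ
  set c := ∫ ω, φ (X 0 ω) ∂P with hc
  have hφm : Measurable φ := measurable_scoreProduct (measurable_marginalCDF (X 0)) k k'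
  have hφb : ∀ y, |φ y| ≤ 1 / 4 := abs_scoreProduct_le (X 0) k k'
  have hcb : |c| ≤ 1 / 4 := by
    have h := norm_integral_le_of_norm_le_const (μ := P) (f := fun ω => φ (X 0 ω))
      (Eventually.of_forall fun ω => hφb _)
    simpa using h
  have hZm : ∀ i, Measurable fun ω => φ (X i ω) - c := fun i => (hφm.comp (hX i)).sub_const c
  have hZb : ∀ i ω, |φ (X i ω) - c| ≤ 1 / 2 := fun i ω => by
    have h1 := abs_le.1 (hφb (X i ω))
    have h2 := abs_le.1 hcb
    rw [abs_le]
    constructor <;> linarith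
  have hZ0 : ∀ i, ∫ ω, (φ (X i ω) - c) ∂P = 0 := fun i => by
    have hi : Integrable (fun ω => φ (X i ω)) P :=
      integrable_of_measurable_of_abs_le (hφm.comp (hX i)) fun ω => hφb _
    have hm : ∫ ω, φ (X i ω) ∂P = c := ((hident i).comp hφm).integral_eq
    rw [integral_sub hi (integrable_const c), hm]
    simp
  have hsq := integral_sq_sum_le_of_orthogonal (P := P) (Finset.range n)
    (Z := fun i ω => φ (X i ω) - c) (C := 1 / 2) (fun i _ => hZm i) (fun i _ => hZb i)
    fun i _ j _ hij => by
      have hij' : IndepFun (fun ω => φ (X i ω) - c) (fun ω => φ (X j ω) - c) P :=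
        (hind.indepFun hij).comp (hφm.sub_const c) (hφm.sub_const c)
      rw [hij'.integral_fun_mul_eq_mul_integral (hZm i).aestronglyMeasurable
        (hZm j).aestronglyMeasurable, hZ0, zero_mul]
  have heq : ∀ ω, 4 / (n : ℝ) * ∑ i ∈ Finset.range n, φ (X i ω) - rankCovMatrix P (X 0) k k' =
      4 / (n : ℝ) * ∑ i ∈ Finset.range n, (φ (X i ω) - c) := fun ω => by
    rw [rankCovMatrix_apply (hX 0) hF, Finset.sum_sub_distrib, Finset.sum_const,
      Finset.card_range, nsmul_eq_mul]
    field_simp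
    rfl
  simp_rw [heq]
  refine integral_abs_le_sqrt ?_ ?_
  · have h : MemLp (fun ω => ∑ i ∈ Finset.range n, (φ (X i ω) - c)) 2 P :=
      memLp_finsetSum _ fun i _ => memLp_of_measurable_of_abs_le (hZm i) (hZb i)
    exact h.const_mul _
  · simp_rw [mul_pow]
    rw [integral_const_mul]
    refine (mul_le_mul_of_nonneg_left hsq (by positivity)).trans (le_of_eq ?_)
    rw [Finset.card_range]
    field_simp
    norm_num

lemma integrable_abs_empiricalCDF_sub (hX : ∀ i, Measurable (X i)) (n i : ℕ) (k : Fin K) :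
    Integrable (fun ω => |empiricalCDF n (fun i => X i ω) k (X i ω k) -
      marginalCDF P (X 0) k (X i ω k)|) P := by
  refine (integrable_of_measurable_of_abs_le (C := 1) ((measurable_empiricalCDF hX n i k).sub
    ((measurable_marginalCDF (X 0) k).comp (measurable_pi_apply k |>.comp (hX i))))
    fun ω => ?_).abs
  have h1 := abs_le.1 (abs_empiricalCDF_sub_half_le n (fun i => X i ω) k (X i ω k))
  have h2 := abs_le.1 (abs_marginalCDF_sub_half_le (P := P) (X 0) k (X i ω k))
  rw [abs_le]
  simp only [Pi.sub_apply, Function.comp_apply]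
  constructor <;> linarith

lemma integral_abs_empiricalCovMatrix_sub_le (hX : ∀ i, Measurable (X i)) (hind : iIndepFun X P)
    (hident : ∀ i, IdentDistrib (X i) (X 0) P P) {n : ℕ} (hn : n ≠ 0) (k k' : Fin K) :
    ∫ ω, |empiricalCovMatrix n (fun i => X i ω) k k' -
        4 / (n : ℝ) * ∑ i ∈ Finset.range n, scoreProduct (marginalCDF P (X 0)) k k' (X i ω)| ∂P ≤
      4 * √((n : ℝ)⁻¹) := by
  have hn' : (n : ℝ) ≠ 0 := Nat.cast_ne_zero.2 hn
  have hcdf : ∀ k i, ∫ ω, |empiricalCDF n (fun i => X i ω) k (X i ω k) -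
      marginalCDF P (X 0) k (X i ω k)| ∂P ≤ √((n : ℝ)⁻¹) := fun k i => by
    have hXk : ∀ i, Measurable fun ω => X i ω k := fun i => measurable_pi_apply k |>.comp (hX i)
    have := Measure.isProbabilityMeasure_map (μ := P) (hXk 0).aemeasurable
    exact integral_abs_empirical_sub_cdf_le (μ := P.map fun ω => X 0 ω k)
      (ξ := fun i ω => X i ω k) hXk
      (hind.comp (fun _ x => x k) fun _ => measurable_pi_apply k)
      (fun i => ((hident i).comp (measurable_pi_apply k)).map_eq) hn i
  have hint : ∀ i, Integrable (fun ω =>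
      |empiricalCDF n (fun i => X i ω) k (X i ω k) - marginalCDF P (X 0) k (X i ω k)| +
      |empiricalCDF n (fun i => X i ω) k' (X i ω k') - marginalCDF P (X 0) k' (X i ω k')|) P :=
    fun i => (integrable_abs_empiricalCDF_sub hX n i k).add
      (integrable_abs_empiricalCDF_sub hX n i k')
  refine (integral_mono_of_nonneg (Eventually.of_forall fun ω => abs_nonneg _)
    ((integrable_finsetSum (Finset.range n) fun i _ => hint i).const_mul (2 / (n : ℝ)))
    (Eventually.of_forall fun ω =>
      abs_empiricalCovMatrix_sub_le n (fun i => X i ω) (X 0) k k')).trans ?_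
  rw [integral_const_mul, integral_finsetSum _ fun i _ => hint i]
  calc _ ≤ 2 / (n : ℝ) * ∑ _i ∈ Finset.range n, 2 * √((n : ℝ)⁻¹) := by
        refine mul_le_mul_of_nonneg_left (Finset.sum_le_sum fun i _ => ?_) (by positivity)
        rw [integral_add (integrable_abs_empiricalCDF_sub hX n i k)
          (integrable_abs_empiricalCDF_sub hX n i k')]
        linarith [hcdf k i, hcdf k' i]
    _ = 4 * √((n : ℝ)⁻¹) := by
        rw [Finset.sum_const, Finset.card_range, nsmul_eq_mul]
        field_simp
        norm_num

lemma tendsto_sqrt_const_div (c : ℝ) : Tendsto (fun n : ℕ => √(c / n)) atTop (𝓝 0) := by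
  simpa using (tendsto_const_div_atTop_nhds_zero_nat c).sqrt

lemma tendstoInMeasure_empiricalCovMatrix_apply (hX : ∀ i, Measurable (X i))
    (hind : iIndepFun X P) (hident : ∀ i, IdentDistrib (X i) (X 0) P P)
    (hF : ∀ k, Continuous (marginalCDF P (X 0) k)) (k k' : Fin K) :
    TendstoInMeasure P (fun n ω => empiricalCovMatrix n (fun i => X i ω) k k') atTop
      fun _ => rankCovMatrix P (X 0) k k' := by
  have hmean : ∀ n : ℕ, Integrable (fun ω => 4 / (n : ℝ) * ∑ i ∈ Finset.range n,
      scoreProduct (marginalCDF P (X 0)) k k' (X i ω)) P := fun n =>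
    (integrable_finsetSum _ fun i _ => integrable_of_measurable_of_abs_le
      ((measurable_scoreProduct (measurable_marginalCDF (X 0)) k k').comp (hX i))
      fun ω => abs_scoreProduct_le (X 0) k k' _).const_mul _
  have hemp : ∀ n : ℕ, Integrable (fun ω => empiricalCovMatrix n (fun i => X i ω) k k') P :=
    fun n => (integrable_finsetSum _ fun i _ => integrable_of_measurable_of_abs_le
      (((measurable_empiricalCDF hX n i k).sub_const _).mul
        ((measurable_empiricalCDF hX n i k').sub_const _)) (C := 1 / 2 * (1 / 2)) fun ω => by
          rw [Pi.mul_apply, abs_mul]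
          exact mul_le_mul (abs_empiricalCDF_sub_half_le _ _ _ _)
            (abs_empiricalCDF_sub_half_le _ _ _ _) (abs_nonneg _) (by norm_num)).const_mul _
  refine tendstoInMeasure_of_integral_norm_le (b := fun n => 4 * √(1 / n) + √(4 / n))
    (fun n => (hemp n).sub (integrable_const _)) ?_
    (by simpa using ((tendsto_sqrt_const_div 1).const_mul 4).add (tendsto_sqrt_const_div 4))
  filter_upwards [eventually_ne_atTop 0] with n hn
  have h1 := integral_abs_empiricalCovMatrix_sub_le hX hind hident hn k k'
  have h2 := integral_abs_mean_scoreProduct_sub_le hX hind hident hF hn k k'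
  have i1 := ((hemp n).sub (hmean n)).abs
  have i2 := ((hmean n).sub (integrable_const (rankCovMatrix P (X 0) k k'))).abs
  rw [one_div]
  exact (integral_mono ((hemp n).sub (integrable_const _)).norm (i1.add i2)
    fun ω => abs_sub_le _ _ _).trans ((integral_add i1 i2).le.trans (add_le_add h1 h2))

end Consistency

/-! ### The limit law of the statistic -/

section Limit

variable {Ω : Type*} [MeasurableSpace Ω] {P : Measure Ω} [IsProbabilityMeasure P] {K : ℕ}
  {X : ℕ → Ω → Fin K → ℝ}

/-- Matrix inversion on arrays. -/
noncomputable def invArray (M : Fin K → Fin K → ℝ) : Fin K → Fin K → ℝ :=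
  fun i j => (Matrix.of M)⁻¹ i j

lemma continuousAt_invArray {M : Fin K → Fin K → ℝ} (hM : (Matrix.of M).det ≠ 0) :
    ContinuousAt (invArray (K := K)) M := by
  refine continuousAt_matrix_inv (Matrix.of M) ?_
  rw [Ring.inverse_eq_inv']
  exact continuousAt_inv₀ hM

/-- Inversion need not be continuous at singular matrices, so measurability comes from the formula
`det⁻¹ • adjugate`, which also covers the value `0` there. -/
lemma measurable_invArray : Measurable (invArray (K := K)) := by
  refine measurable_pi_lambda _ fun i => measurable_pi_lambda _ fun j => ?_
  have hc : Continuous fun M : Fin K → Fin K → ℝ => Matrix.of M := continuous_id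
  have hadj : Continuous fun M : Fin K → Fin K → ℝ => (Matrix.of M).adjugate i j :=
    hc.matrix_adjugate.matrix_elem i j
  simp only [invArray, Matrix.inv_def, Ring.inverse_eq_inv', Matrix.smul_apply, smul_eq_mul]
  exact hc.matrix_det.measurable.inv.mul hadj.measurable

/-- The quadratic form of an array. -/
def quadraticForm (p : EuclideanSpace ℝ (Fin K) × (Fin K → Fin K → ℝ)) : ℝ :=
  ∑ i, p.1 i * ∑ j, p.2 i j * p.1 j

lemma continuous_quadraticForm : Continuous (quadraticForm (K := K)) := by
  unfold quadraticForm
  fun_prop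

open scoped MatrixOrder in
-- The Gaussian vector is `R z` with `R` the symmetric square root of `S` and `z` standard; since `R
-- S⁻¹ R = 1`, the form becomes `z ⬝ᵥ z`.
lemma map_quadraticForm_multivariateGaussian {S : Matrix (Fin K) (Fin K) ℝ} (hS : S.PosDef) :
    (multivariateGaussian 0 S).map (fun z => quadraticForm (z, fun i j => S⁻¹ i j)) =
      chiSquared K := by
  have hq : Measurable fun z : EuclideanSpace ℝ (Fin K) =>
      quadraticForm (z, fun i j => S⁻¹ i j) :=
    (continuous_quadraticForm.comp (by fun_prop)).measurable
  have hnn : 0 ≤ S := Matrix.nonneg_iff_posSemidef.2 hS.posSemidef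
  set R := CFC.sqrt S with hR
  have hRR : R * R = S := CFC.sqrt_mul_sqrt_self S hnn
  have hRT : R.transpose = R := by
    rw [← Matrix.conjTranspose_eq_transpose_of_trivial]
    exact (Matrix.nonneg_iff_posSemidef.1 (CFC.sqrt_nonneg S)).isHermitian
  have hdet : IsUnit R.det := by
    have h := hS.det_pos.ne'
    rw [← hRR, Matrix.det_mul] at h
    exact isUnit_iff_ne_zero.2 (left_ne_zero_of_mul h)
  have hid : R * S⁻¹ * R = 1 := by
    rw [← hRR, Matrix.mul_inv_rev, ← mul_assoc, Matrix.mul_nonsing_inv _ hdet, one_mul,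
      Matrix.nonsing_inv_mul _ hdet]
  rw [multivariateGaussian, ← map_pi_eq_stdGaussian, Measure.map_map hq (by fun_prop),
    Measure.map_map (hq.comp (by fun_prop)) (by fun_prop), chiSquared]
  congr 1
  ext z
  have hform : quadraticForm (WithLp.toLp 2 (R.mulVec z), fun i j => S⁻¹ i j) =
      R.mulVec z ⬝ᵥ S⁻¹.mulVec (R.mulVec z) := rfl
  simp only [Function.comp_apply, zero_add, Matrix.toEuclideanCLM_toLp, ← hR, hform]
  have hv : R.mulVec z = Matrix.vecMul z R := by rw [← Matrix.vecMul_transpose, hRT]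
  rw [hv, ← Matrix.dotProduct_mulVec, Matrix.mulVec_mulVec, ← hv, Matrix.mulVec_mulVec, hid,
    Matrix.one_mulVec]
  simp [dotProduct, sq]

lemma tendstoInMeasure_wilcoxonVector_sub (hX : ∀ i, Measurable (X i)) (hind : iIndepFun X P)
    (hident : ∀ i, IdentDistrib (X i) (X 0) P P)
    (hF : ∀ k, Continuous (marginalCDF P (X 0) k)) {n₁ : ℕ → ℕ} {t₁ : ℝ}
    (ht₁ : t₁ ∈ Set.Ioo (0 : ℝ) 1)
    (hn₁ : Tendsto (fun n : ℕ => (n₁ n : ℝ) / (n : ℝ)) atTop (𝓝 t₁)) :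
    TendstoInMeasure P (fun n ω k => wilcoxonVector n (n₁ n) (fun i => X i ω) k -
      projectionVector (marginalCDF P (X 0)) n (n₁ n) (fun i => X i ω) k) atTop fun _ => 0 := by
  have hXk : ∀ i k, Measurable fun ω => X i ω k := fun i k => measurable_pi_apply k |>.comp (hX i)
  have : ∀ k, IsProbabilityMeasure (P.map fun ω => X 0 ω k) := fun k =>
    Measure.isProbabilityMeasure_map (hXk 0 k).aemeasurable
  refine tendstoInMeasure_pi fun k => ?_
  refine tendstoInMeasure_of_integral_norm_le (b := fun n => √(9 / n)) (fun n => ?_) ?_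
    (tendsto_sqrt_const_div 9)
  · simp only [Pi.zero_apply, sub_zero]
    exact (memLp_wilcoxonVector_sub_projectionVector (ν := fun k => P.map fun ω => X 0 ω k)
      hX n (n₁ n) k).integrable one_le_two
  · filter_upwards [eventually_pos_and_lt ht₁ hn₁] with n hn
    simp only [Pi.zero_apply, sub_zero, Real.norm_eq_abs]
    exact integral_abs_wilcoxonVector_sub_projectionVector_le
      (ν := fun k => P.map fun ω => X 0 ω k) hX hind
      (fun i k => ((hident i).comp (measurable_pi_apply k)).map_eq) hF hn.1 hn.2 k

lemma tendstoInDistribution_wilcoxonVector (hX : ∀ i, Measurable (X i)) (hind : iIndepFun X P)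
    (hident : ∀ i, IdentDistrib (X i) (X 0) P P)
    (hF : ∀ k, Continuous (marginalCDF P (X 0) k)) {n₁ : ℕ → ℕ} {t₁ : ℝ}
    (ht₁ : t₁ ∈ Set.Ioo (0 : ℝ) 1)
    (hn₁ : Tendsto (fun n : ℕ => (n₁ n : ℝ) / (n : ℝ)) atTop (𝓝 t₁))
    (hS : (rankCovMatrix P (X 0)).PosSemidef) :
    TendstoInDistribution
      (fun n ω => WithLp.toLp 2 (wilcoxonVector n (n₁ n) fun i => X i ω))
      atTop id (fun _ => P) (multivariateGaussian 0 (rankCovMatrix P (X 0))) := by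
  refine tendstoInDistribution_of_tendstoInMeasure_sub _ _
    (tendstoInDistribution_projectionVector hX hind hident hF ht₁ hn₁ hS) ?_
    fun n => ((WithLp.measurable_toLp 2 _).comp
      (measurable_wilcoxonVector hX n (n₁ n))).aemeasurable
  exact tendstoInMeasure_comp_of_continuousAt (f := WithLp.toLp 2)
    (tendstoInMeasure_wilcoxonVector_sub hX hind hident hF ht₁ hn₁)
    (PiLp.continuous_toLp 2 _).continuousAt

lemma tendstoInMeasure_empiricalCovMatrix (hX : ∀ i, Measurable (X i))
    (hind : iIndepFun X P) (hident : ∀ i, IdentDistrib (X i) (X 0) P P)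
    (hF : ∀ k, Continuous (marginalCDF P (X 0) k)) :
    TendstoInMeasure P (fun n ω (k k' : Fin K) => empiricalCovMatrix n (fun i => X i ω) k k')
      atTop fun _ k k' => rankCovMatrix P (X 0) k k' :=
  tendstoInMeasure_pi fun k => tendstoInMeasure_pi fun k' =>
    tendstoInMeasure_empiricalCovMatrix_apply hX hind hident hF k k'

lemma measurable_empiricalCovMatrix_array (hX : ∀ i, Measurable (X i)) (n : ℕ) :
    Measurable fun ω (k k' : Fin K) => empiricalCovMatrix n (fun i => X i ω) k k' :=
  measurable_pi_lambda _ fun k => measurable_pi_lambda _ fun k' =>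
    measurable_empiricalCovMatrix hX n k k'

/-- Invertible matrices form an open neighbourhood of `Σ`, and `Σ̂_n` converges to `Σ` in
probability. -/
lemma tendsto_measure_isUnit_empiricalCovMatrix (hX : ∀ i, Measurable (X i))
    (hind : iIndepFun X P) (hident : ∀ i, IdentDistrib (X i) (X 0) P P)
    (hF : ∀ k, Continuous (marginalCDF P (X 0) k)) (hS : (rankCovMatrix P (X 0)).PosDef) :
    Tendsto (fun n => P {ω | IsUnit (empiricalCovMatrix n fun i => X i ω)}) atTop (𝓝 1) := by
  have hc : Continuous fun M : Fin K → Fin K → ℝ => (Matrix.of M).det :=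
    Continuous.matrix_det continuous_id
  have hmem : {M : Fin K → Fin K → ℝ | (Matrix.of M).det ≠ 0} ∈
      𝓝 fun k k' => rankCovMatrix P (X 0) k k' :=
    (isOpen_ne_fun hc continuous_const).mem_nhds hS.det_pos.ne'
  refine (tendsto_measure_mem_of_tendstoInMeasure
    (tendstoInMeasure_empiricalCovMatrix hX hind hident hF) hmem).congr fun n => ?_
  congr 1
  ext ω
  change (empiricalCovMatrix n fun i => X i ω).det ≠ 0 ↔
    IsUnit (empiricalCovMatrix n fun i => X i ω)
  rw [Matrix.isUnit_iff_isUnit_det, isUnit_iff_ne_zero]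

lemma tendstoInDistribution_wilcoxonStatistic (hX : ∀ i, Measurable (X i)) (hind : iIndepFun X P)
    (hident : ∀ i, IdentDistrib (X i) (X 0) P P)
    (hF : ∀ k, Continuous (marginalCDF P (X 0) k)) {n₁ : ℕ → ℕ} {t₁ : ℝ}
    (ht₁ : t₁ ∈ Set.Ioo (0 : ℝ) 1)
    (hn₁ : Tendsto (fun n : ℕ => (n₁ n : ℝ) / (n : ℝ)) atTop (𝓝 t₁))
    (hS : (rankCovMatrix P (X 0)).PosDef) :
    TendstoInDistribution (fun n ω => wilcoxonStatistic n (n₁ n) fun i => X i ω)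
      atTop (id : ℝ → ℝ) (fun _ => P) (chiSquared K) := by
  have hinv : TendstoInMeasure P
      (fun n ω => invArray fun k k' => empiricalCovMatrix n (fun i => X i ω) k k') atTop
      fun _ => invArray fun k k' => rankCovMatrix P (X 0) k k' :=
    tendstoInMeasure_comp_of_continuousAt (tendstoInMeasure_empiricalCovMatrix hX hind hident hF)
      (continuousAt_invArray hS.det_pos.ne')
  have h : TendstoInDistribution (fun n ω => wilcoxonStatistic n (n₁ n) fun i => X i ω) atTop
      (fun z => quadraticForm (z, fun i j => (rankCovMatrix P (X 0))⁻¹ i j)) (fun _ => P)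
      (multivariateGaussian 0 (rankCovMatrix P (X 0))) :=
    (tendstoInDistribution_wilcoxonVector hX hind hident hF ht₁ hn₁
      hS.posSemidef).continuous_comp_prodMk_of_tendstoInMeasure_const
      (g := quadraticForm) continuous_quadraticForm hinv fun n =>
        (measurable_invArray.comp (measurable_empiricalCovMatrix_array hX n)).aemeasurable
  -- The limit in `h` is a quadratic form on the Gaussian space; only its law matters, so it may be
  -- replaced by the identity under `chiSquared K`.
  refine ⟨h.1, aemeasurable_id, ?_⟩
  convert h.tendsto using 2
  refine congrArg 𝓝 (Subtype.ext ?_)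
  change Measure.map id (chiSquared K) = _
  rw [Measure.map_id, ← map_quadraticForm_multivariateGaussian hS]

end Limit

end MultivariateWilcoxon

theorem theorem1 {Ω : Type*} [MeasurableSpace Ω] (P : Measure Ω) [IsProbabilityMeasure P]
    (K : ℕ) (X : ℕ → Ω → Fin K → ℝ)
    (hX_meas : ∀ i, Measurable (X i))
    (hX_indep : iIndepFun X P)
    (hX_ident : ∀ i, IdentDistrib (X i) (X 0) P P)
    (hF : ∀ k, Continuous (MultivariateWilcoxon.marginalCDF P (X 0) k))
    (n₁ : ℕ → ℕ) (t₁ : ℝ) (ht₁ : t₁ ∈ Set.Ioo (0 : ℝ) 1)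
    (hn₁ : Tendsto (fun n : ℕ => (n₁ n : ℝ) / (n : ℝ)) atTop (𝓝 t₁))
    (hSigma : (MultivariateWilcoxon.rankCovMatrix P (X 0)).PosDef) :
    Tendsto (fun n : ℕ => P {ω | IsUnit (MultivariateWilcoxon.empiricalCovMatrix n
        (fun i => X i ω))}) atTop (𝓝 1) ∧
      TendstoInDistribution
        (fun (n : ℕ) (ω : Ω) => MultivariateWilcoxon.wilcoxonStatistic n (n₁ n) (fun i => X i ω))
        atTop (id : ℝ → ℝ) (fun _ => P) (MultivariateWilcoxon.chiSquared K) :=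
  ⟨MultivariateWilcoxon.tendsto_measure_isUnit_empiricalCovMatrix hX_meas hX_indep hX_ident hF
      hSigma,
    MultivariateWilcoxon.tendstoInDistribution_wilcoxonStatistic hX_meas hX_indep hX_ident hF ht₁
      hn₁ hSigma⟩
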